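/- For every $N\in\mathbb N$ let $U_N(\sigma)$, $\sigma\in\{-1,1\}^N$, be independent centred Gaussian random variables of variance $N$ (the random energy model, REM), all defined on one probability space; the joint law for different $N$ is arbitrary. On $\ell^2(\{-1,1\}^N)$ let $|-\rangle$ be the flat state, $\langle\sigma|-\rangle=2^{-N/2}$ for all $\sigma$, let $W_N=N\left(|-\rangle\langle-|-1\right)$ be the generator of the all-to-all dynamics, and let $U_N$ act as the multiplication (diagonal) operator. Then, for any $t>0$ and $\lambda\ge 0$, for almost every realisation of the REM the limit $$\theta(t,\lambda):=\lim_{N\to\infty}\frac1{Nt}\ln\langle-|e^{t(W_N-\lambda U_N)}|-\rangle$$ (the scaled cumulant generating function) exists and $$\theta(t,\lambda)=\max\left\{0,\;t^{-1}p_0(t\lambda)-1\right\},$$ where, with $\beta_c:=\sqrt{2\ln 2}$, $$p_0(\beta):=\begin{cases}\beta^2/2, & \beta\le\beta_c,\\ \beta\beta_c-\ln 2, & \beta>\beta_c.\end{cases}$$ -/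

import Mathlib

open MeasureTheory ProbabilityTheory Filter Topology
open scoped Matrix NNReal

noncomputable section

/-- The configuration space `{-1, 1} ^ N` of `N` Ising spins (`ℤˣ = {1, -1}`). -/
abbrev SpinConfig (N : ℕ) : Type := Fin N → ℤˣ

/-- `U` is a random energy model on `{-1, 1} ^ N`: the energies `U σ` are independent centred
Gaussian random variables of variance `N`. -/
structure IsREM {Ω : Type*} [MeasurableSpace Ω] (N : ℕ) (U : SpinConfig N → Ω → ℝ)
    (P : Measure Ω) : Prop where
  hasLaw : ∀ σ, HasLaw (U σ) (gaussianReal 0 (N : ℝ≥0)) P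
  indep : iIndepFun U P

/-- The flat state `|−⟩`, with all amplitudes equal to `2 ^ (-N / 2)`. -/
def flatState (N : ℕ) : SpinConfig N → ℝ := fun _ => (2 : ℝ) ^ (-(N : ℝ) / 2)

/-- The all-to-all generator `W = N (|−⟩⟨−| - 1)`. -/
def allToAllGenerator (N : ℕ) : Matrix (SpinConfig N) (SpinConfig N) ℝ :=
  (N : ℝ) • (Matrix.vecMulVec (flatState N) (flatState N) - 1)

/-- The tilted generator `W - lam U`, where the energy `u` acts by multiplication. -/
def tiltedGenerator (N : ℕ) (lam : ℝ) (u : SpinConfig N → ℝ) :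
    Matrix (SpinConfig N) (SpinConfig N) ℝ :=
  allToAllGenerator N - lam • Matrix.diagonal u

/-- The moment generating function `Z(t, lam) = ⟨−| exp (t (W - lam U)) |−⟩`. -/
def momentGen (N : ℕ) (t lam : ℝ) (u : SpinConfig N → ℝ) : ℝ :=
  flatState N ⬝ᵥ (NormedSpace.exp (t • tiltedGenerator N lam u) *ᵥ flatState N)

/-- The critical inverse temperature `√(2 ln 2)` of the random energy model. -/
def betaCrit : ℝ := √(2 * Real.log 2)

/-- The pressure of the random energy model. -/
def remPressure (β : ℝ) : ℝ :=
  if β ≤ betaCrit then β ^ 2 / 2 else β * betaCrit - Real.log 2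

end

/-!
Since `N |−⟩⟨−|` has rank one, Duhamel's formula for `exp (s (W - lam U))` closes up into a scalar
renewal equation (`momentGen_renewal`) for `f s = momentGen N s lam u`,
`f s = g s + N ∫₀ˢ g (s - r) f r dr`, whose kernel `g s = exp (-s N) Z (s lam)` involves only the
normalised partition function `Z β = 2⁻ᴺ ∑ σ, exp (-β u σ)` (`boltzmannMean`) of the diagonal
energy. The whole asymptotics is read off from this equation.

*Lower bounds.* As `f ≥ 0`, the equation gives `f t ≥ g t`, which is the term
`t⁻¹ * remPressure (t * lam) - 1` of the limit. If the mean energy is at most of order `N ε`, then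
`g s ≥ exp (-s N (1 + ε))` by Jensen's inequality, and comparison with the kernel `exp (-s N)`, whose
renewal solution is constant, yields `f t ≥ exp (-t N ε)`, which is the term `0`.

*Upper bound.* Let `θ` be the claimed limit and tilt `f` and `g` by `exp (-N (θ + 2 ε) s)`. By
log-convexity of `Z`, bounds on `Z (s₀ lam)` and `Z (t lam)` control `Z (s lam)` for all `s ≤ t`: up
to a small time `s₀` the tilted kernel is at most `exp (-N (1 + ε) s)`, and afterwards it is
exponentially small in `N`. Its mass, multiplied by `N`, is thus at most some `q < 1`, and evaluating
the renewal equation at a maximum shows that the tilted `f` is bounded by `1 / (1 - q)`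
(`renewal_le`, `momentGen_le`).

*Random energies.* It remains to know that `N⁻¹ ln Z β → remPressure β` almost surely for each fixed
`β ≥ 0`. The upper bound is Markov's inequality and Borel–Cantelli for `β ≤ betaCrit`; larger `β`
follow from `β = betaCrit` by monotonicity of `ℓᵖ` norms (`boltzmannMean_le_of_le`). The lower bound
counts the energies near `-x N` with `x < betaCrit`, where the expected number is exponentially large
and Chebyshev's inequality applies (`IsREM.measureReal_sum_indicator_le`). The joint law for
different `N` plays no role in Borel–Cantelli.
-/

/-! ### Averages of Boltzmann weights -/

/-- The normalised partition function `2⁻ᴺ ∑ σ, exp (-β u σ)` of a diagonal energy `u`. -/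
noncomputable def boltzmannMean (N : ℕ) (β : ℝ) (u : SpinConfig N → ℝ) : ℝ :=
  ∑ σ, ((2 : ℝ) ^ N)⁻¹ * Real.exp (-(β * u σ))

theorem card_spinConfig (N : ℕ) : Fintype.card (SpinConfig N) = 2 ^ N := by
  simp [SpinConfig]

theorem sum_inv_two_pow (N : ℕ) : ∑ _σ : SpinConfig N, ((2 : ℝ) ^ N)⁻¹ = 1 := by
  rw [Finset.sum_const, Finset.card_univ, card_spinConfig]
  simp

theorem flatState_mul_self (N : ℕ) (σ : SpinConfig N) :
    flatState N σ * flatState N σ = ((2 : ℝ) ^ N)⁻¹ := by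
  rw [flatState, ← Real.rpow_add two_pos, ← Real.rpow_natCast, ← Real.rpow_neg two_pos.le]
  congr 1
  ring

theorem boltzmannMean_pos (N : ℕ) (β : ℝ) (u : SpinConfig N → ℝ) : 0 < boltzmannMean N β u :=
  Finset.sum_pos (fun _ _ => by positivity) Finset.univ_nonempty

theorem continuous_boltzmannMean (N : ℕ) (u : SpinConfig N → ℝ) :
    Continuous fun β => boltzmannMean N β u := by
  unfold boltzmannMean
  fun_prop

/-- Jensen's inequality in the form of log-convexity in the inverse temperature between `0` and
`b`: an exponential bound at `b` gives exponential bounds at all smaller arguments. -/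
theorem boltzmannMean_le_exp_of_le {N : ℕ} {u : SpinConfig N → ℝ} {lam s T K : ℝ} (hs : 0 ≤ s)
    (hsT : s ≤ T) (h : boltzmannMean N (T * lam) u ≤ Real.exp (T * K)) :
    boltzmannMean N (s * lam) u ≤ Real.exp (s * K) := by
  rcases hs.eq_or_lt with rfl | hs
  · simp [boltzmannMean]
  have hT : 0 < T := hs.trans_le hsT
  have hp : 1 ≤ T / s := by rwa [le_div_iff₀ hs, one_mul]
  have key := Real.arith_mean_le_rpow_mean (Finset.univ : Finset (SpinConfig N))
    (fun _ => ((2 : ℝ) ^ N)⁻¹) (fun σ => Real.exp (-(s * lam * u σ))) (fun _ _ => by positivity)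
    (sum_inv_two_pow N) (fun _ _ => by positivity) hp
  have hexp : ∀ σ, Real.exp (-(s * lam * u σ)) ^ (T / s) = Real.exp (-(T * lam * u σ)) := by
    intro σ
    rw [← Real.exp_mul]
    congr 1
    field_simp
  simp only [hexp] at key
  calc boltzmannMean N (s * lam) u ≤ boltzmannMean N (T * lam) u ^ (1 / (T / s)) := key
    _ ≤ Real.exp (T * K) ^ (1 / (T / s)) :=
        Real.rpow_le_rpow (boltzmannMean_pos ..).le h (by positivity)
    _ = Real.exp (s * K) := by
        rw [← Real.exp_mul]
        congr 1
        field_simp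

theorem exp_neg_mul_mean_le_boltzmannMean (N : ℕ) (β : ℝ) (u : SpinConfig N → ℝ) :
    Real.exp (-(β * ∑ σ, ((2 : ℝ) ^ N)⁻¹ * u σ)) ≤ boltzmannMean N β u := by
  have key := convexOn_exp.map_sum_le (t := (Finset.univ : Finset (SpinConfig N)))
    (w := fun _ => ((2 : ℝ) ^ N)⁻¹) (p := fun σ => -(β * u σ)) (fun _ _ => by positivity)
    (sum_inv_two_pow N) (fun _ _ => Set.mem_univ _)
  simp only [smul_eq_mul] at key
  refine le_trans (le_of_eq ?_) key
  congr 1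
  rw [Finset.mul_sum, ← Finset.sum_neg_distrib]
  exact Finset.sum_congr rfl fun σ _ => by ring

/-- Above `b`, the partition function is controlled by the one at `b` through the monotonicity of
`ℓᵖ` norms, `∑ a ^ p ≤ (∑ a) ^ p` for `p ≥ 1`. -/
theorem boltzmannMean_le_of_le {N : ℕ} {u : SpinConfig N → ℝ} {b β K : ℝ} (hb : 0 < b)
    (hbβ : b ≤ β) (h : boltzmannMean N b u ≤ Real.exp (N * K)) :
    boltzmannMean N β u ≤ Real.exp (N * ((Real.log 2 + K) * (β / b) - Real.log 2)) := by
  set p := β / b with hpdef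
  have hp : 1 ≤ p := by rwa [hpdef, le_div_iff₀ hb, one_mul]
  have hpow : (2 : ℝ) ^ N = Real.exp (N * Real.log 2) := by
    rw [mul_comm, ← Real.rpow_def_of_pos two_pos, Real.rpow_natCast]
  set S := ∑ σ, Real.exp (-(b * u σ)) with hS
  have hSpos : 0 < S := Finset.sum_pos (fun _ _ => Real.exp_pos _) Finset.univ_nonempty
  have hSle : S ≤ Real.exp (N * (Real.log 2 + K)) := by
    rw [boltzmannMean, ← Finset.mul_sum, inv_mul_le_iff₀ (by positivity)] at h
    refine h.trans_eq ?_
    rw [hpow, ← Real.exp_add]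
    congr 1
    ring
  have hterm : ∀ σ, Real.exp (-(β * u σ)) ≤ S ^ p * (Real.exp (-(b * u σ)) / S) := by
    intro σ
    have h1 : Real.exp (-(b * u σ)) / S ≤ 1 := by
      rw [div_le_one hSpos]
      exact Finset.single_le_sum (f := fun σ => Real.exp (-(b * u σ)))
        (fun _ _ => (Real.exp_pos _).le) (Finset.mem_univ σ)
    have h2 : Real.exp (-(β * u σ)) = S ^ p * (Real.exp (-(b * u σ)) / S) ^ p := by
      rw [← Real.mul_rpow hSpos.le (by positivity), mul_div_cancel₀ _ hSpos.ne', ← Real.exp_mul]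
      congr 1
      rw [hpdef]
      field_simp
    rw [h2]
    refine mul_le_mul_of_nonneg_left ?_ (by positivity)
    simpa using Real.rpow_le_rpow_of_exponent_ge (by positivity) h1 hp
  calc boltzmannMean N β u = ((2 : ℝ) ^ N)⁻¹ * ∑ σ, Real.exp (-(β * u σ)) := by
        rw [boltzmannMean, Finset.mul_sum]
    _ ≤ ((2 : ℝ) ^ N)⁻¹ * ∑ σ, S ^ p * (Real.exp (-(b * u σ)) / S) := by
        gcongr with σ
        exact hterm σ
    _ = ((2 : ℝ) ^ N)⁻¹ * S ^ p := by
        rw [← Finset.mul_sum, ← Finset.sum_div, ← hS, div_self hSpos.ne', mul_one]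
    _ ≤ ((2 : ℝ) ^ N)⁻¹ * Real.exp (N * (Real.log 2 + K)) ^ p := by
        gcongr
    _ = Real.exp (N * ((Real.log 2 + K) * p - Real.log 2)) := by
        rw [hpow, ← Real.exp_neg, ← Real.exp_mul, ← Real.exp_add]
        congr 1
        ring

/-! ### The renewal equation -/

theorem tiltedGenerator_mulVec_apply (N : ℕ) (lam : ℝ) (u φ : SpinConfig N → ℝ)
    (σ : SpinConfig N) :
    (tiltedGenerator N lam u *ᵥ φ) σ =
      N * flatState N σ * (flatState N ⬝ᵥ φ) - (N + lam * u σ) * φ σ := by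
  simp only [tiltedGenerator, allToAllGenerator, Matrix.sub_mulVec, Matrix.smul_mulVec,
    Matrix.vecMulVec_mulVec, Matrix.one_mulVec, Pi.sub_apply, Pi.smul_apply, smul_eq_mul,
    Matrix.mulVec_diagonal, MulOpposite.smul_eq_mul_unop, MulOpposite.unop_op]
  ring

theorem tiltedGenerator_transpose (N : ℕ) (lam : ℝ) (u : SpinConfig N → ℝ) :
    (tiltedGenerator N lam u)ᵀ = tiltedGenerator N lam u := by
  simp [tiltedGenerator, allToAllGenerator, Matrix.transpose_vecMulVec]

/-- The moment generating function is a squared norm, `‖exp (t A / 2) |−⟩‖²`, as the tilted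
generator `A` is symmetric. -/
theorem momentGen_nonneg (N : ℕ) (t lam : ℝ) (u : SpinConfig N → ℝ) :
    0 ≤ momentGen N t lam u := by
  set H := (t / 2) • tiltedGenerator N lam u with hH
  have h1 : t • tiltedGenerator N lam u = H + H := by
    rw [hH, ← add_smul, add_halves]
  have h2 : (NormedSpace.exp H)ᵀ = NormedSpace.exp H := by
    rw [← Matrix.exp_transpose, hH, Matrix.transpose_smul, tiltedGenerator_transpose]
  rw [momentGen, h1, Matrix.exp_add_of_commute H H (Commute.refl H), ← Matrix.mulVec_mulVec,
    Matrix.dotProduct_mulVec]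
  nth_rewrite 1 [← h2]
  rw [Matrix.vecMul_transpose]
  exact Finset.sum_nonneg fun _ _ => mul_self_nonneg _

open scoped Matrix.Norms.Operator in
theorem hasDerivAt_exp_smul_mulVec {n : Type*} [Fintype n] [DecidableEq n] (A : Matrix n n ℝ)
    (v : n → ℝ) (i : n) (s : ℝ) :
    HasDerivAt (fun s : ℝ => (NormedSpace.exp (s • A) *ᵥ v) i)
      ((A *ᵥ (NormedSpace.exp (s • A) *ᵥ v)) i) s := by
  have h := hasDerivAt_exp_smul_const' (𝕂 := ℝ) A s
  let L : Matrix n n ℝ →ₗ[ℝ] ℝ :=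
    { toFun := fun B => (B *ᵥ v) i
      map_add' := fun B C => by simp [Matrix.add_mulVec]
      map_smul' := fun c B => by simp [Matrix.smul_mulVec] }
  have h3 := (LinearMap.toContinuousLinearMap L).hasFDerivAt.comp_hasDerivAt s h
  rw [Matrix.mulVec_mulVec]
  exact h3

theorem continuous_momentGen (N : ℕ) (lam : ℝ) (u : SpinConfig N → ℝ) :
    Continuous fun s => momentGen N s lam u := by
  unfold momentGen dotProduct
  refine continuous_finsetSum _ fun σ _ => continuous_const.mul ?_
  exact continuous_iff_continuousAt.2 fun s =>
    (hasDerivAt_exp_smul_mulVec (tiltedGenerator N lam u) (flatState N) σ s).continuousAt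

/-- Since the part `N |−⟩⟨−|` of the generator has rank one, Duhamel's formula closes
up into a scalar renewal equation for the moment generating function. -/
theorem momentGen_renewal (N : ℕ) (lam : ℝ) (u : SpinConfig N → ℝ) (s : ℝ) :
    momentGen N s lam u = Real.exp (-(s * N)) * boltzmannMean N (s * lam) u +
      N * ∫ r in (0 : ℝ)..s, Real.exp (-((s - r) * N)) * boltzmannMean N ((s - r) * lam) u *
        momentGen N r lam u := by
  set v := flatState N with hv
  set φ : ℝ → SpinConfig N → ℝ :=
    fun s => NormedSpace.exp (s • tiltedGenerator N lam u) *ᵥ v with hφ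
  have hf : Continuous fun s => momentGen N s lam u := continuous_momentGen N lam u
  have hcomp : ∀ σ, φ s σ = Real.exp (-(s * (N + lam * u σ))) * v σ +
      ∫ r in (0 : ℝ)..s, N * v σ * (Real.exp (-((s - r) * (N + lam * u σ))) *
        momentGen N r lam u) := by
    intro σ
    have hd : ∀ r, HasDerivAt (fun r => Real.exp (-((s - r) * (N + lam * u σ))) * φ r σ)
        (N * v σ * (Real.exp (-((s - r) * (N + lam * u σ))) * momentGen N r lam u)) r := by
      intro r
      have h1 : HasDerivAt (fun r => Real.exp (-((s - r) * (N + lam * u σ))))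
          (Real.exp (-((s - r) * (N + lam * u σ))) * (N + lam * u σ)) r := by
        have h0 : HasDerivAt (fun r => -((s - r) * (N + lam * u σ))) (N + lam * u σ) r := by
          have := (((hasDerivAt_id r).const_sub s).mul_const (N + lam * u σ)).fun_neg
          simpa using this
        exact h0.exp
      have h2 := hasDerivAt_exp_smul_mulVec (tiltedGenerator N lam u) v σ r
      rw [tiltedGenerator_mulVec_apply] at h2
      refine (h1.mul h2).congr_deriv ?_
      simp only [momentGen, ← hv]
      ring
    have hint := intervalIntegral.integral_eq_sub_of_hasDerivAt (a := 0) (b := s)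
      (fun r _ => hd r) (Continuous.intervalIntegrable (by fun_prop) _ _)
    have h0 : φ 0 σ = v σ := by simp [hφ]
    rw [hint]
    simp only [h0, sub_self, zero_mul, neg_zero, Real.exp_zero, one_mul, sub_zero]
    ring
  have hsum : momentGen N s lam u = ∑ σ, v σ * φ s σ := rfl
  rw [hsum]
  simp only [hcomp, mul_add (v _), Finset.sum_add_distrib]
  have hw : ∀ r σ, Real.exp (-(r * (N + lam * u σ))) =
      Real.exp (-(r * N)) * Real.exp (-(r * lam * u σ)) := by
    intro r σ
    rw [← Real.exp_add]
    congr 1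
    ring
  congr 1
  · rw [boltzmannMean, Finset.mul_sum]
    refine Finset.sum_congr rfl fun σ _ => ?_
    rw [hw, ← flatState_mul_self N σ]
    ring
  · simp only [← intervalIntegral.integral_const_mul]
    rw [← intervalIntegral.integral_finsetSum
      (fun σ _ => Continuous.intervalIntegrable (by fun_prop) _ _)]
    refine intervalIntegral.integral_congr fun r _ => ?_
    simp only [boltzmannMean, Finset.mul_sum, Finset.sum_mul]
    refine Finset.sum_congr rfl fun σ _ => ?_
    rw [hw, ← flatState_mul_self N σ]
    ring

/-- A renewal equation is stable under multiplication of both functions by `exp (-z s)`. -/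
theorem renewal_tilt {f g : ℝ → ℝ} {a : ℝ}
    (h : ∀ s, f s = g s + a * ∫ r in (0 : ℝ)..s, g (s - r) * f r) (z s : ℝ) :
    Real.exp (-(z * s)) * f s = Real.exp (-(z * s)) * g s +
      a * ∫ r in (0 : ℝ)..s, (Real.exp (-(z * (s - r))) * g (s - r)) *
        (Real.exp (-(z * r)) * f r) := by
  rw [h s, mul_add, mul_left_comm, ← intervalIntegral.integral_const_mul]
  congr 2
  refine intervalIntegral.integral_congr fun r _ => ?_
  have : Real.exp (-(z * s)) = Real.exp (-(z * (s - r))) * Real.exp (-(z * r)) := by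
    rw [← Real.exp_add]
    congr 1
    ring
  simp only [this]
  ring

/-- A subcritical renewal kernel, `a ∫ g ≤ q < 1`, keeps the solution bounded. -/
theorem renewal_le {f g : ℝ → ℝ} {a q T : ℝ} (hf : Continuous f) (hg : Continuous g)
    (ha : 0 ≤ a) (hT : 0 ≤ T) (hq : q < 1) (hf0 : ∀ s, 0 ≤ f s)
    (hg0 : ∀ s, 0 ≤ g s) (hg1 : ∀ s ∈ Set.Icc 0 T, g s ≤ 1)
    (hgq : ∀ s ∈ Set.Icc 0 T, a * ∫ r in (0 : ℝ)..s, g r ≤ q)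
    (h : ∀ s, f s = g s + a * ∫ r in (0 : ℝ)..s, g (s - r) * f r) :
    f T ≤ (1 - q)⁻¹ := by
  -- evaluate the equation at the point where `f` is maximal
  obtain ⟨x, hx, hmax⟩ := isCompact_Icc.exists_isMaxOn (Set.nonempty_Icc.2 hT) hf.continuousOn
  refine (hmax ⟨hT, le_rfl⟩).trans ?_
  have hint : ∫ r in (0 : ℝ)..x, g (x - r) * f r ≤ (∫ r in (0 : ℝ)..x, g r) * f x := by
    have h1 : ∫ r in (0 : ℝ)..x, g (x - r) * f r ≤ ∫ r in (0 : ℝ)..x, g (x - r) * f x :=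
      intervalIntegral.integral_mono_on hx.1 (Continuous.intervalIntegrable (by fun_prop) _ _)
        (Continuous.intervalIntegrable (by fun_prop) _ _)
        fun r hr => mul_le_mul_of_nonneg_left (hmax ⟨hr.1, hr.2.trans hx.2⟩) (hg0 _)
    rw [intervalIntegral.integral_mul_const, intervalIntegral.integral_comp_sub_left] at h1
    simpa using h1
  have hle : f x ≤ 1 + q * f x := by
    calc f x = g x + a * ∫ r in (0 : ℝ)..x, g (x - r) * f r := h x
      _ ≤ 1 + a * ((∫ r in (0 : ℝ)..x, g r) * f x) := by
          gcongr
          exact hg1 x hx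
      _ ≤ 1 + q * f x := by
          rw [← mul_assoc]
          gcongr
          · exact hf0 x
          · exact hgq x hx
  change f x ≤ _
  rw [inv_eq_one_div, le_div_iff₀ (by linarith)]
  linarith

/-- The kernel `a exp (-a s)` has total mass one and the constant solution `1`; larger kernels have
larger solutions. -/
theorem one_le_of_renewal {f g : ℝ → ℝ} {a T : ℝ} (hf : Continuous f) (hg : Continuous g)
    (ha : 0 ≤ a) (hT : 0 ≤ T) (hf0 : ∀ s, 0 ≤ f s)
    (hga : ∀ s ∈ Set.Icc 0 T, Real.exp (-(a * s)) ≤ g s)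
    (h : ∀ s, f s = g s + a * ∫ r in (0 : ℝ)..s, g (s - r) * f r) :
    1 ≤ f T := by
  -- evaluate the equation at the point where `f` is minimal
  obtain ⟨x, hx, hmin⟩ := isCompact_Icc.exists_isMinOn (Set.nonempty_Icc.2 hT) hf.continuousOn
  refine le_trans ?_ (hmin ⟨hT, le_rfl⟩)
  change 1 ≤ f x
  have hI : a * ∫ r in (0 : ℝ)..x, Real.exp (-(a * (x - r))) = 1 - Real.exp (-(a * x)) := by
    have hd : ∀ r, HasDerivAt (fun r => Real.exp (-(a * (x - r))))
        (a * Real.exp (-(a * (x - r)))) r := by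
      intro r
      have h0 : HasDerivAt (fun r => -(a * (x - r))) a r := by
        simpa using (((hasDerivAt_id r).const_sub x).const_mul a).fun_neg
      simpa [mul_comm] using h0.exp
    rw [← intervalIntegral.integral_const_mul, intervalIntegral.integral_eq_sub_of_hasDerivAt
      (fun r _ => hd r) (Continuous.intervalIntegrable (by fun_prop) _ _)]
    simp
  have hint : (∫ r in (0 : ℝ)..x, Real.exp (-(a * (x - r)))) * f x ≤
      ∫ r in (0 : ℝ)..x, g (x - r) * f r := by
    rw [← intervalIntegral.integral_mul_const]
    refine intervalIntegral.integral_mono_on hx.1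
      (Continuous.intervalIntegrable (by fun_prop) _ _)
      (Continuous.intervalIntegrable (by fun_prop) _ _) fun r hr => ?_
    have h1 := hga (x - r) ⟨by linarith [hr.2], by linarith [hr.1, hx.2]⟩
    exact mul_le_mul h1 (hmin ⟨hr.1, hr.2.trans hx.2⟩) (hf0 _) ((Real.exp_pos _).le.trans h1)
  have hle : Real.exp (-(a * x)) + (1 - Real.exp (-(a * x))) * f x ≤ f x := by
    calc _ = Real.exp (-(a * x)) +
          a * ((∫ r in (0 : ℝ)..x, Real.exp (-(a * (x - r)))) * f x) := by
          rw [← mul_assoc, hI]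
      _ ≤ g x + a * ∫ r in (0 : ℝ)..x, g (x - r) * f r := by
          gcongr
          exact hga x hx
      _ = f x := (h x).symm
  have := Real.exp_pos (-(a * x))
  nlinarith

/-! ### The free energy of the random energy model -/

section REM

variable {Ω : Type*} [MeasurableSpace Ω] {P : Measure Ω}

theorem betaCrit_pos : 0 < betaCrit :=
  Real.sqrt_pos.2 (mul_pos two_pos (Real.log_pos one_lt_two))

theorem betaCrit_sq : betaCrit ^ 2 = 2 * Real.log 2 :=
  Real.sq_sqrt (mul_pos two_pos (Real.log_pos one_lt_two)).le

theorem IsREM.integrable_exp {N : ℕ} {U : SpinConfig N → Ω → ℝ} (hU : IsREM N U P) (β : ℝ)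
    (σ : SpinConfig N) : Integrable (fun ω => Real.exp (-(β * U σ ω))) P := by
  have h := integrable_exp_mul_gaussianReal (μ := 0) (v := (N : ℝ≥0)) (-β)
  rw [← (hU.hasLaw σ).map_eq] at h
  simpa [Function.comp_def] using h.comp_aemeasurable (hU.hasLaw σ).aemeasurable

theorem IsREM.integral_boltzmannMean {N : ℕ} {U : SpinConfig N → Ω → ℝ} (hU : IsREM N U P)
    (β : ℝ) :
    ∫ ω, boltzmannMean N β (fun σ => U σ ω) ∂P = Real.exp (N * (β ^ 2 / 2)) := by
  have h1 : ∀ σ, ∫ ω, Real.exp (-(β * U σ ω)) ∂P = Real.exp (N * (β ^ 2 / 2)) := by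
    intro σ
    have h := mgf_gaussianReal (hU.hasLaw σ).map_eq (-β)
    simp only [mgf, neg_mul] at h
    rw [h]
    congr 1
    simp
    ring
  simp only [boltzmannMean]
  rw [integral_finsetSum _ fun σ _ => (hU.integrable_exp β σ).const_mul _]
  simp only [integral_const_mul, h1]
  rw [← Finset.sum_mul, sum_inv_two_pow, one_mul]

/-- Borel–Cantelli for events with geometrically small probabilities. -/
theorem ae_eventually_not_of_measureReal_le [IsProbabilityMeasure P] {s : ℕ → Set Ω}
    {b : ℕ → ℝ} (hb : Summable b) (hs : ∀ᶠ N in atTop, P.real (s N) ≤ b N) :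
    ∀ᵐ ω ∂P, ∀ᶠ N in atTop, ω ∉ s N := by
  refine ae_eventually_notMem ?_
  have hsum : Summable fun N => P.real (s N) := by
    refine Summable.of_norm_bounded_eventually_nat hb (hs.mono fun N hN => ?_)
    rwa [Real.norm_of_nonneg measureReal_nonneg]
  have : ∀ N, P (s N) = ENNReal.ofReal (P.real (s N)) := fun N => by
    rw [ofReal_measureReal]
  simp only [this]
  exact hsum.tsum_ofReal_ne_top

theorem summable_exp_neg_natCast_mul {δ : ℝ} (hδ : 0 < δ) :
    Summable fun N : ℕ => Real.exp (-(N * δ)) := by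
  refine (Real.summable_exp_nat_mul_iff.2 (neg_lt_zero.2 hδ)).congr fun N => ?_
  rw [mul_neg]

/-- The annealed upper bound, from the first moment. -/
theorem IsREM.ae_eventually_boltzmannMean_le_annealed [IsProbabilityMeasure P]
    {U : (N : ℕ) → SpinConfig N → Ω → ℝ} (hU : ∀ N, IsREM N (U N) P) (β : ℝ) {δ : ℝ}
    (hδ : 0 < δ) :
    ∀ᵐ ω ∂P, ∀ᶠ N : ℕ in atTop,
      boltzmannMean N β (fun σ => U N σ ω) ≤ Real.exp (N * (β ^ 2 / 2 + δ)) := by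
  have key := ae_eventually_not_of_measureReal_le (P := P)
    (s := fun N => {ω | Real.exp (N * (β ^ 2 / 2 + δ)) ≤ boltzmannMean N β fun σ => U N σ ω})
    (summable_exp_neg_natCast_mul hδ) (Eventually.of_forall fun N => by
      have h := mul_meas_ge_le_integral_of_nonneg (μ := P)
        (f := fun ω => boltzmannMean N β fun σ => U N σ ω)
        (Eventually.of_forall fun ω => (boltzmannMean_pos _ _ _).le)
        (integrable_finsetSum _ fun σ _ => ((hU N).integrable_exp β σ).const_mul _)
        (Real.exp (N * (β ^ 2 / 2 + δ)))
      rw [(hU N).integral_boltzmannMean, ← le_div_iff₀' (Real.exp_pos _), ← Real.exp_sub] at h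
      refine h.trans_eq ?_
      congr 1
      ring)
  filter_upwards [key] with ω hω
  filter_upwards [hω] with N hN
  exact (not_le.1 hN).le

theorem IsREM.ae_eventually_boltzmannMean_le [IsProbabilityMeasure P]
    {U : (N : ℕ) → SpinConfig N → Ω → ℝ} (hU : ∀ N, IsREM N (U N) P) (β : ℝ) {δ : ℝ}
    (hδ : 0 < δ) :
    ∀ᵐ ω ∂P, ∀ᶠ N : ℕ in atTop,
      boltzmannMean N β (fun σ => U N σ ω) ≤ Real.exp (N * (remPressure β + δ)) := by
  by_cases hβ : β ≤ betaCrit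
  · simpa only [remPressure, if_pos hβ] using
      IsREM.ae_eventually_boltzmannMean_le_annealed hU β hδ
  · have hβ' := not_le.1 hβ
    have hc := betaCrit_pos
    have hβ0 := hc.trans hβ'
    -- at the critical point the annealed bound is still sharp
    have hδ' : 0 < δ * (betaCrit / β) := by positivity
    filter_upwards [IsREM.ae_eventually_boltzmannMean_le_annealed hU betaCrit hδ'] with ω hω
    filter_upwards [hω] with N hN
    refine (boltzmannMean_le_of_le hc hβ'.le hN).trans_eq ?_
    rw [remPressure, if_neg hβ]
    have hsq := betaCrit_sq
    congr 2
    have : Real.log 2 + (betaCrit ^ 2 / 2 + δ * (betaCrit / β)) =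
        betaCrit ^ 2 + δ * (betaCrit / β) := by linarith
    rw [this]
    field_simp
    ring

/-- The Gaussian probability of the energy window `[-(x N + 1), -x N]` is at least
`exp (-N (x² / 2 + δ))`. -/
theorem eventually_exp_le_gaussianReal_Icc (x : ℝ) (hx : 0 ≤ x) {δ : ℝ} (hδ : 0 < δ) :
    ∀ᶠ N : ℕ in atTop, Real.exp (-(N * (x ^ 2 / 2 + δ))) ≤
      (gaussianReal 0 (N : ℝ≥0)).real (Set.Icc (-(x * N + 1)) (-(x * N))) := by
  have hlim : Tendsto (fun N : ℕ => (N : ℝ) * Real.exp (-(N * δ))) atTop (𝓝 0) := by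
    have h1 := (Real.tendsto_pow_mul_exp_neg_atTop_nhds_zero 1).comp
      (tendsto_natCast_atTop_atTop.atTop_mul_const hδ)
    have h2 := h1.const_mul δ⁻¹
    rw [mul_zero] at h2
    refine h2.congr fun N => ?_
    simp only [Function.comp_apply, pow_one]
    field_simp
  have hev := hlim.eventually (gt_mem_nhds (show 0 < Real.exp (-(x + 1)) / (2 * Real.pi) by
    positivity))
  filter_upwards [hev, eventually_ge_atTop 1] with N hN hN1
  have hN1' : (1 : ℝ) ≤ N := by exact_mod_cast hN1
  have hN0 : (N : ℝ≥0) ≠ 0 := by exact_mod_cast (by omega : N ≠ 0)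
  set c := (√(2 * Real.pi * N))⁻¹ * Real.exp (-(x * N + 1) ^ 2 / (2 * N)) with hc
  have hc0 : 0 ≤ c := by positivity
  have hpdf : ∀ y ∈ Set.Icc (-(x * N + 1)) (-(x * N)), c ≤ gaussianPDFReal 0 (N : ℝ≥0) y := by
    intro y hy
    simp only [gaussianPDFReal, hc, sub_zero, NNReal.coe_natCast]
    have hxN : 0 ≤ x * N := by positivity
    have : y ^ 2 ≤ (x * N + 1) ^ 2 := by nlinarith [hy.1, hy.2]
    gcongr
  have hmeas : c ≤ (gaussianReal 0 (N : ℝ≥0)).real (Set.Icc (-(x * N + 1)) (-(x * N))) := by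
    rw [measureReal_def, ← ENNReal.ofReal_le_iff_le_toReal (measure_ne_top _ _),
      gaussianReal_apply _ hN0]
    calc ENNReal.ofReal c
        = ∫⁻ _ in Set.Icc (-(x * N + 1)) (-(x * N)), ENNReal.ofReal c := by
          rw [setLIntegral_const, Real.volume_Icc]
          simp
      _ ≤ _ := setLIntegral_mono (measurable_gaussianPDF _ _) fun y hy =>
          ENNReal.ofReal_le_ofReal (hpdf y hy)
  refine le_trans ?_ hmeas
  have hsqrt : √(2 * Real.pi * N) ≤ 2 * Real.pi * N :=
    Real.sqrt_le_iff.2 ⟨by positivity, le_self_pow₀ (by nlinarith [Real.pi_gt_three]) two_ne_zero⟩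
  have hexp : Real.exp (-(N * (x ^ 2 / 2))) * Real.exp (-(x + 1)) ≤
      Real.exp (-(x * N + 1) ^ 2 / (2 * N)) := by
    rw [← Real.exp_add, Real.exp_le_exp, le_div_iff₀ (by positivity)]
    nlinarith
  calc Real.exp (-(N * (x ^ 2 / 2 + δ)))
      = Real.exp (-(N * (x ^ 2 / 2))) * Real.exp (-(N * δ)) := by
        rw [← Real.exp_add]
        congr 1
        ring
    _ ≤ Real.exp (-(N * (x ^ 2 / 2))) * (Real.exp (-(x + 1)) / (2 * Real.pi) / N) := by
        gcongr
        rw [le_div_iff₀ (by positivity), mul_comm]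
        exact hN.le
    _ = (2 * Real.pi * N)⁻¹ * (Real.exp (-(N * (x ^ 2 / 2))) * Real.exp (-(x + 1))) := by
        field_simp
    _ ≤ c := by
        rw [hc]
        gcongr

/-- Chebyshev's inequality for the number of energies in a window `S`, written as a sum of
indicators. -/
theorem IsREM.measureReal_sum_indicator_le [IsProbabilityMeasure P] {N : ℕ}
    {U : SpinConfig N → Ω → ℝ} (hU : IsREM N U P) {S : Set ℝ} (hS : MeasurableSet S)
    (hpos : 0 < (gaussianReal 0 (N : ℝ≥0)).real S) :
    P.real {ω | ∑ σ, S.indicator (1 : ℝ → ℝ) (U σ ω) ≤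
        2 ^ N * (gaussianReal 0 (N : ℝ≥0)).real S / 2} ≤
      4 / (2 ^ N * (gaussianReal 0 (N : ℝ≥0)).real S) := by
  set p := (gaussianReal 0 (N : ℝ≥0)).real S with hp
  have hind : Measurable (S.indicator (1 : ℝ → ℝ)) := measurable_one.indicator hS
  set X : SpinConfig N → Ω → ℝ := fun σ => S.indicator (1 : ℝ → ℝ) ∘ U σ with hX
  have hXm : ∀ σ, AEStronglyMeasurable (X σ) P := fun σ =>
    (hind.comp_aemeasurable (hU.hasLaw σ).aemeasurable).aestronglyMeasurable
  have hXL : ∀ σ, MemLp (X σ) 2 P := fun σ =>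
    MemLp.of_bound (hXm σ) 1 (Eventually.of_forall fun ω => by
      simp only [hX, Function.comp_apply, Set.indicator]
      split_ifs <;> simp)
  have hEX : ∀ σ, ∫ ω, X σ ω ∂P = p := by
    intro σ
    rw [hX, (hU.hasLaw σ).integral_comp hind.aestronglyMeasurable, integral_indicator_one hS]
  have hVX : ∀ σ, Var[X σ; P] ≤ p := by
    intro σ
    refine (variance_le_expectation_sq (hXm σ)).trans_eq ?_
    rw [← hEX σ]
    refine integral_congr_ae (Eventually.of_forall fun ω => ?_)
    simp only [hX, Pi.pow_apply, Function.comp_apply, Set.indicator]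
    split_ifs <;> simp
  have hindep : iIndepFun X P := hU.indep.comp _ fun _ => hind
  have hV : Var[∑ σ, X σ; P] ≤ 2 ^ N * p := by
    rw [IndepFun.variance_sum (fun σ _ => hXL σ) fun i _ j _ hij => hindep.indepFun hij]
    refine (Finset.sum_le_sum fun σ _ => hVX σ).trans_eq ?_
    rw [Finset.sum_const, Finset.card_univ, card_spinConfig]
    simp
  have hE : ∫ ω, (∑ σ, X σ) ω ∂P = 2 ^ N * p := by
    simp only [Finset.sum_apply]
    rw [integral_finsetSum _ fun σ _ => (hXL σ).integrable one_le_two]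
    simp only [hEX, Finset.sum_const, Finset.card_univ, card_spinConfig]
    simp
  have hc : 0 < 2 ^ N * p / 2 := by positivity
  have hcheb := meas_ge_le_variance_div_sq
    (memLp_finsetSum' Finset.univ fun σ _ => hXL σ) hc
  rw [hE] at hcheb
  have hcheb' : P.real {ω | 2 ^ N * p / 2 ≤ |(∑ σ, X σ) ω - 2 ^ N * p|} ≤
      Var[∑ σ, X σ; P] / (2 ^ N * p / 2) ^ 2 :=
    ENNReal.toReal_le_of_le_ofReal (div_nonneg (variance_nonneg _ _) (by positivity)) hcheb
  calc _ ≤ P.real {ω | 2 ^ N * p / 2 ≤ |(∑ σ, X σ) ω - 2 ^ N * p|} := by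
        refine measureReal_mono fun ω hω => ?_
        simp only [Set.mem_ofPred_eq, Finset.sum_apply, hX, Function.comp_apply] at hω ⊢
        rw [abs_of_nonpos (by linarith)]
        linarith
    _ ≤ Var[∑ σ, X σ; P] / (2 ^ N * p / 2) ^ 2 := hcheb'
    _ ≤ 2 ^ N * p / (2 ^ N * p / 2) ^ 2 := by gcongr
    _ = 4 / (2 ^ N * p) := by
        field_simp
        norm_num

/-- The contribution of the energies close to `-x N`, for a level `x` below the extremal one. -/
theorem IsREM.ae_eventually_exp_le_boltzmannMean_of_lt [IsProbabilityMeasure P]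
    {U : (N : ℕ) → SpinConfig N → Ω → ℝ} (hU : ∀ N, IsREM N (U N) P) {β x : ℝ} (hβ : 0 ≤ β)
    (hx : 0 ≤ x) (hxc : x < betaCrit) {δ : ℝ} (hδ : 0 < δ) :
    ∀ᵐ ω ∂P, ∀ᶠ N : ℕ in atTop,
      Real.exp (N * (β * x - x ^ 2 / 2 - δ)) ≤ boltzmannMean N β (fun σ => U N σ ω) := by
  have hκ : 0 < Real.log 2 - x ^ 2 / 2 := by
    have := betaCrit_sq
    nlinarith
  set κ := Real.log 2 - x ^ 2 / 2 with hκdef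
  set S : ℕ → Set ℝ := fun N => Set.Icc (-(x * N + 1)) (-(x * N)) with hSdef
  have hS : ∀ N, MeasurableSet (S N) := fun N => measurableSet_Icc
  have hpow : ∀ N : ℕ, (2 : ℝ) ^ N = Real.exp (N * Real.log 2) := fun N => by
    rw [mul_comm, ← Real.rpow_def_of_pos two_pos, Real.rpow_natCast]
  have key := ae_eventually_not_of_measureReal_le (P := P)
    (s := fun N => {ω | ∑ σ, (S N).indicator (1 : ℝ → ℝ) (U N σ ω) ≤
        2 ^ N * (gaussianReal 0 (N : ℝ≥0)).real (S N) / 2})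
    ((summable_exp_neg_natCast_mul (half_pos hκ)).mul_left 4) (by
      filter_upwards [eventually_exp_le_gaussianReal_Icc x hx (half_pos hκ)] with N hN
      refine ((hU N).measureReal_sum_indicator_le (hS N) ((Real.exp_pos _).trans_le hN)).trans ?_
      rw [div_eq_mul_inv, Real.exp_neg]
      gcongr
      calc Real.exp (N * (κ / 2)) = 2 ^ N * Real.exp (-(N * (x ^ 2 / 2 + κ / 2))) := by
            rw [hpow, ← Real.exp_add]
            congr 1
            rw [hκdef]
            ring
        _ ≤ _ := by gcongr)
  have hhalf : ∀ᶠ N : ℕ in atTop, 2 ≤ Real.exp (N * (δ / 2)) :=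
    (Real.tendsto_exp_atTop.comp
      (tendsto_natCast_atTop_atTop.atTop_mul_const (half_pos hδ))).eventually_ge_atTop 2
  filter_upwards [key] with ω hω
  filter_upwards [hω, hhalf, eventually_exp_le_gaussianReal_Icc x hx (half_pos hδ)]
    with N hN h2 hp
  have hN := not_le.1 hN
  have hterm : ∀ σ, (S N).indicator (1 : ℝ → ℝ) (U N σ ω) * Real.exp (N * (β * x)) ≤
      Real.exp (-(β * U N σ ω)) := by
    intro σ
    by_cases h : U N σ ω ∈ S N
    · rw [Set.indicator_of_mem h, Pi.one_apply, one_mul, Real.exp_le_exp]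
      nlinarith [h.2]
    · rw [Set.indicator_of_notMem h, zero_mul]
      positivity
  calc Real.exp (N * (β * x - x ^ 2 / 2 - δ))
      = Real.exp (-(N * (x ^ 2 / 2 + δ / 2))) * Real.exp (N * (β * x)) /
          Real.exp (N * (δ / 2)) := by
        rw [← Real.exp_add, ← Real.exp_sub]
        congr 1
        ring
    _ ≤ (gaussianReal 0 (N : ℝ≥0)).real (S N) * Real.exp (N * (β * x)) / 2 := by
        gcongr
    _ = (2 ^ N)⁻¹ * (2 ^ N * (gaussianReal 0 (N : ℝ≥0)).real (S N) / 2 *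
          Real.exp (N * (β * x))) := by
        field_simp
    _ ≤ (2 ^ N)⁻¹ * ((∑ σ, (S N).indicator (1 : ℝ → ℝ) (U N σ ω)) *
          Real.exp (N * (β * x))) := by
        gcongr
    _ ≤ boltzmannMean N β fun σ => U N σ ω := by
        rw [boltzmannMean, ← Finset.mul_sum, Finset.sum_mul]
        gcongr with σ
        exact hterm σ

theorem IsREM.ae_eventually_exp_le_boltzmannMean [IsProbabilityMeasure P]
    {U : (N : ℕ) → SpinConfig N → Ω → ℝ} (hU : ∀ N, IsREM N (U N) P) {β : ℝ} (hβ : 0 ≤ β)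
    {δ : ℝ} (hδ : 0 < δ) :
    ∀ᵐ ω ∂P, ∀ᶠ N : ℕ in atTop,
      Real.exp (N * (remPressure β - δ)) ≤ boltzmannMean N β (fun σ => U N σ ω) := by
  -- `x ↦ β x - x² / 2` takes the value `remPressure β` at `min β betaCrit`
  obtain ⟨x, hx0, hxc, hx⟩ : ∃ x, 0 ≤ x ∧ x < betaCrit ∧
      remPressure β - δ ≤ β * x - x ^ 2 / 2 - δ / 2 := by
    set m := min β betaCrit with hm
    have hval : β * m - m ^ 2 / 2 = remPressure β := by
      rw [remPressure, hm]
      split_ifs with h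
      · rw [min_eq_left h]
        ring
      · rw [min_eq_right (not_le.1 h).le, betaCrit_sq]
        ring
    have hm0 : 0 ≤ m := le_min hβ betaCrit_pos.le
    rcases hm0.eq_or_lt with h0 | h0
    · refine ⟨0, le_rfl, betaCrit_pos, ?_⟩
      rw [← hval, ← h0]
      simp
      linarith
    · have hcont : Tendsto (fun x : ℝ => β * x - x ^ 2 / 2) (𝓝[<] m) (𝓝 (remPressure β)) := by
        rw [← hval]
        exact (Continuous.tendsto (by fun_prop) m).mono_left nhdsWithin_le_nhds
      have h1 := hcont.eventually (lt_mem_nhds (show remPressure β - δ / 2 < remPressure β by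
        linarith))
      obtain ⟨x, hx, hx'⟩ := (h1.and (Ioo_mem_nhdsLT h0)).exists
      exact ⟨x, hx'.1.le, hx'.2.trans_le (min_le_right _ _), by linarith⟩
  filter_upwards [IsREM.ae_eventually_exp_le_boltzmannMean_of_lt hU hβ hx0 hxc (half_pos hδ)]
    with ω hω
  filter_upwards [hω] with N hN
  refine le_trans ?_ hN
  gcongr

end REM

/-! ### Bounds on the moment generating function -/

theorem exp_mul_boltzmannMean_le_momentGen {N : ℕ} {t : ℝ} (ht : 0 ≤ t) (lam : ℝ)
    (u : SpinConfig N → ℝ) :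
    Real.exp (-(t * N)) * boltzmannMean N (t * lam) u ≤ momentGen N t lam u := by
  rw [momentGen_renewal]
  refine le_add_of_nonneg_right (mul_nonneg (Nat.cast_nonneg _) ?_)
  exact intervalIntegral.integral_nonneg ht fun r _ =>
    mul_nonneg (mul_nonneg (Real.exp_pos _).le (boltzmannMean_pos ..).le) (momentGen_nonneg ..)

theorem exp_le_momentGen_of_mean_le {N : ℕ} {t lam ε : ℝ} {u : SpinConfig N → ℝ} (ht : 0 ≤ t)
    (h : lam * ∑ σ, ((2 : ℝ) ^ N)⁻¹ * u σ ≤ N * ε) :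
    Real.exp (-(t * (N * ε))) ≤ momentGen N t lam u := by
  have hbm := continuous_boltzmannMean N u
  have hf := continuous_momentGen N lam u
  have key := one_le_of_renewal (T := t)
    (f := fun s => Real.exp (-(-(N * ε) * s)) * momentGen N s lam u)
    (g := fun s => Real.exp (-(-(N * ε) * s)) *
      (Real.exp (-(s * N)) * boltzmannMean N (s * lam) u))
    (a := N) (by fun_prop) (by fun_prop) (Nat.cast_nonneg N) ht
    (fun s => mul_nonneg (Real.exp_pos _).le (momentGen_nonneg ..))
    (fun s hs => by
      refine le_trans ?_ (mul_le_mul_of_nonneg_left (mul_le_mul_of_nonneg_left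
        (exp_neg_mul_mean_le_boltzmannMean N (s * lam) u) (Real.exp_pos _).le)
        (Real.exp_pos _).le)
      rw [← Real.exp_add, ← Real.exp_add, Real.exp_le_exp]
      nlinarith [mul_le_mul_of_nonneg_left h hs.1])
    (renewal_tilt (momentGen_renewal N lam u) _)
  have h2 : Real.exp (-(t * (N * ε))) * Real.exp (-(-(N * ε) * t)) = 1 := by
    rw [← Real.exp_add, Real.exp_eq_one_iff]
    ring
  calc Real.exp (-(t * (N * ε)))
      ≤ Real.exp (-(t * (N * ε))) * (Real.exp (-(-(N * ε) * t)) * momentGen N t lam u) :=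
        le_mul_of_one_le_right (Real.exp_pos _).le key
    _ = momentGen N t lam u := by rw [← mul_assoc, h2, one_mul]

theorem integral_exp_neg_mul_le {c : ℝ} (hc : 0 < c) (s : ℝ) :
    ∫ r in (0 : ℝ)..s, Real.exp (-(c * r)) ≤ c⁻¹ := by
  have hd : ∀ r, HasDerivAt (fun r => -c⁻¹ * Real.exp (-(c * r))) (Real.exp (-(c * r))) r := by
    intro r
    have h0 : HasDerivAt (fun r => -(c * r)) (-c) r := by
      simpa using ((hasDerivAt_id r).const_mul c).fun_neg
    refine (h0.exp.const_mul (-c⁻¹)).congr_deriv ?_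
    field_simp
  rw [intervalIntegral.integral_eq_sub_of_hasDerivAt (fun r _ => hd r)
    (Continuous.intervalIntegrable (by fun_prop) _ _)]
  have : 0 < c⁻¹ * Real.exp (-(c * s)) := by positivity
  simp
  linarith

/-- The upper bound uses the partition function at two temperatures only. The bound at `s₀ * lam`
shows that up to time `s₀` the renewal kernel decays almost at rate `N`, hence has total mass about
one, and the bound at `t * lam` makes the tilted kernel exponentially small between `s₀` and `t`. -/
theorem momentGen_le {N : ℕ} (hN : 0 < N) {t s₀ lam ε θ q : ℝ} {u : SpinConfig N → ℝ}
    (hs₀ : 0 ≤ s₀) (hst : s₀ ≤ t) (hε : 0 < ε) (hθ : 0 ≤ θ)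
    (h₀ : boltzmannMean N (s₀ * lam) u ≤ Real.exp (s₀ * (N * ε)))
    (ht : boltzmannMean N (t * lam) u ≤ Real.exp (t * (N * (1 + θ + ε))))
    (hq : (1 + ε)⁻¹ + N * t * Real.exp (-(N * ε * s₀)) ≤ q) (hq1 : q < 1) :
    momentGen N t lam u ≤ Real.exp (N * (θ + 2 * ε) * t) * (1 - q)⁻¹ := by
  have hbm := continuous_boltzmannMean N u
  have hf := continuous_momentGen N lam u
  have hN' : (0 : ℝ) < N := Nat.cast_pos.2 hN
  set z := N * (θ + 2 * ε) with hz
  set g : ℝ → ℝ := fun s => Real.exp (-(z * s)) *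
    (Real.exp (-(s * N)) * boltzmannMean N (s * lam) u) with hg
  have hgc : Continuous g := by fun_prop
  have hglobal : ∀ s ∈ Set.Icc 0 t, g s ≤ Real.exp (-(N * ε * s)) := by
    intro s hs
    calc g s ≤ Real.exp (-(z * s)) * (Real.exp (-(s * N)) *
          Real.exp (s * (N * (1 + θ + ε)))) := by
          simp only [hg]
          gcongr
          exact boltzmannMean_le_exp_of_le hs.1 hs.2 ht
      _ = Real.exp (-(N * ε * s)) := by
          rw [← Real.exp_add, ← Real.exp_add]
          congr 1
          rw [hz]
          ring
  have hsmall : ∀ s ∈ Set.Icc 0 s₀, g s ≤ Real.exp (-(N * (1 + ε) * s)) := by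
    intro s hs
    calc g s ≤ Real.exp (-(z * s)) * (Real.exp (-(s * N)) * Real.exp (s * (N * ε))) := by
          simp only [hg]
          gcongr
          exact boltzmannMean_le_exp_of_le hs.1 hs.2 h₀
      _ ≤ Real.exp (-(N * (1 + ε) * s)) := by
          rw [← Real.exp_add, ← Real.exp_add, Real.exp_le_exp, hz]
          have : 0 ≤ N * θ * s := mul_nonneg (mul_nonneg hN'.le hθ) hs.1
          nlinarith
  have hsum : ∀ s ∈ Set.Icc 0 t,
      g s ≤ Real.exp (-(N * (1 + ε) * s)) + Real.exp (-(N * ε * s₀)) := by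
    intro s hs
    rcases le_total s s₀ with h | h
    · exact (hsmall s ⟨hs.1, h⟩).trans (le_add_of_nonneg_right (Real.exp_pos _).le)
    · refine (hglobal s hs).trans (le_trans ?_ (le_add_of_nonneg_left (Real.exp_pos _).le))
      gcongr
  have key := renewal_le (T := t) (f := fun s => Real.exp (-(z * s)) * momentGen N s lam u)
    (g := g) (a := N) (q := q) (by fun_prop) hgc hN'.le (hs₀.trans hst) hq1
    (fun s => mul_nonneg (Real.exp_pos _).le (momentGen_nonneg ..))
    (fun s => mul_nonneg (Real.exp_pos _).le
      (mul_nonneg (Real.exp_pos _).le (boltzmannMean_pos ..).le))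
    (fun s hs => (hglobal s hs).trans (Real.exp_le_one_iff.2
      (neg_nonpos.2 (mul_nonneg (mul_nonneg hN'.le hε.le) hs.1))))
    (fun s hs => by
      refine le_trans ?_ hq
      have h1 : ∫ r in (0 : ℝ)..s, g r ≤
          ∫ r in (0 : ℝ)..s, (Real.exp (-(N * (1 + ε) * r)) + Real.exp (-(N * ε * s₀))) :=
        intervalIntegral.integral_mono_on hs.1 (hgc.intervalIntegrable _ _)
          (Continuous.intervalIntegrable (by fun_prop) _ _)
          fun r hr => hsum r ⟨hr.1, hr.2.trans hs.2⟩
      rw [intervalIntegral.integral_add (Continuous.intervalIntegrable (by fun_prop) _ _)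
        (Continuous.intervalIntegrable (by fun_prop) _ _), intervalIntegral.integral_const,
        smul_eq_mul, sub_zero] at h1
      have h2 := integral_exp_neg_mul_le (show 0 < N * (1 + ε) by positivity) s
      calc N * ∫ r in (0 : ℝ)..s, g r
          ≤ N * ((N * (1 + ε))⁻¹ + t * Real.exp (-(N * ε * s₀))) := by
            gcongr
            refine h1.trans (add_le_add h2 ?_)
            gcongr
            exact hs.2
        _ = (1 + ε)⁻¹ + N * t * Real.exp (-(N * ε * s₀)) := by
            field_simp)
    (renewal_tilt (momentGen_renewal N lam u) z)
  rw [Real.exp_neg, inv_mul_le_iff₀ (Real.exp_pos _)] at key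
  exact key

/-! ### The scaled cumulant generating function -/

theorem remPressure_le_mul_max {t : ℝ} (ht : 0 < t) (β : ℝ) :
    remPressure β ≤ t * (1 + max 0 (t⁻¹ * remPressure β - 1)) := by
  have h : t⁻¹ * remPressure β ≤ 1 + max 0 (t⁻¹ * remPressure β - 1) := by
    linarith [le_max_right 0 (t⁻¹ * remPressure β - 1)]
  rwa [inv_mul_le_iff₀ ht] at h

/-- Almost sure convergence up to an error `3 ε`, for each fixed `ε`. Besides the pressure at
`t * lam`, only the annealed bound at the high temperatures `±s₀ * lam` enters: the sign `+` controls
the renewal kernel up to time `s₀`, the sign `-` bounds the mean energy from above. -/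
theorem IsREM.ae_eventually_abs_log_momentGen_sub_le {Ω : Type*} [MeasurableSpace Ω]
    {P : Measure Ω} [IsProbabilityMeasure P] {U : (N : ℕ) → SpinConfig N → Ω → ℝ}
    (hU : ∀ N, IsREM N (U N) P) {t lam : ℝ} (ht : 0 < t) (hlam : 0 ≤ lam) {ε : ℝ}
    (hε : 0 < ε) :
    ∀ᵐ ω ∂P, ∀ᶠ N : ℕ in atTop,
      |((N : ℝ) * t)⁻¹ * Real.log (momentGen N t lam fun σ => U N σ ω) -
        max 0 (t⁻¹ * remPressure (t * lam) - 1)| ≤ 3 * ε := by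
  set θ := max 0 (t⁻¹ * remPressure (t * lam) - 1) with hθ
  have hθ0 : 0 ≤ θ := le_max_left _ _
  -- a time so short that the annealed pressure `(s₀ lam)² / 2` is less than `s₀ ε`
  obtain ⟨s₀, hs₀, hst, hs₀ε⟩ : ∃ s₀, 0 < s₀ ∧ s₀ ≤ t ∧ s₀ * lam ^ 2 ≤ ε := by
    refine ⟨min t (ε / (lam ^ 2 + 1)), by positivity, min_le_left _ _, ?_⟩
    calc min t (ε / (lam ^ 2 + 1)) * lam ^ 2 ≤ ε / (lam ^ 2 + 1) * (lam ^ 2 + 1) := by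
          gcongr
          · exact min_le_right _ _
          · linarith
      _ = ε := by field_simp
  have hδ : 0 < s₀ * ε - (s₀ * lam) ^ 2 / 2 := by
    nlinarith [mul_le_mul_of_nonneg_left hs₀ε hs₀.le, mul_pos hs₀ hε]
  set q := (1 + ε)⁻¹ + ε / (2 * (1 + ε)) with hq
  have hq1 : q < 1 := by
    have : 1 - q = ε / (2 * (1 + ε)) := by
      rw [hq]
      field_simp
      ring
    have h2 : 0 < ε / (2 * (1 + ε)) := by positivity
    linarith
  have hev1 : ∀ᶠ N : ℕ in atTop, N * t * Real.exp (-(N * ε * s₀)) ≤ ε / (2 * (1 + ε)) := by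
    have h1 := ((Real.tendsto_pow_mul_exp_neg_atTop_nhds_zero 1).comp
      (tendsto_natCast_atTop_atTop.atTop_mul_const (mul_pos hε hs₀))).const_mul (t / (ε * s₀))
    rw [mul_zero] at h1
    filter_upwards [h1.eventually (gt_mem_nhds (show 0 < ε / (2 * (1 + ε)) by positivity))]
      with N hN
    refine le_trans (le_of_eq ?_) hN.le
    simp only [Function.comp_apply, pow_one, mul_assoc]
    field_simp
  have hev2 : ∀ᶠ N : ℕ in atTop, (1 - q)⁻¹ ≤ Real.exp (N * (ε * t)) :=
    (Real.tendsto_exp_atTop.comp (tendsto_natCast_atTop_atTop.atTop_mul_const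
      (mul_pos hε ht))).eventually_ge_atTop _
  filter_upwards [IsREM.ae_eventually_boltzmannMean_le_annealed hU (s₀ * lam) hδ,
    IsREM.ae_eventually_boltzmannMean_le_annealed hU (-(s₀ * lam)) hδ,
    IsREM.ae_eventually_boltzmannMean_le hU (t * lam) (mul_pos ht hε),
    IsREM.ae_eventually_exp_le_boltzmannMean hU (mul_nonneg ht.le hlam) (mul_pos ht hε)]
    with ω h1 h2 h3 h4
  filter_upwards [h1, h2, h3, h4, hev1, hev2, eventually_gt_atTop 0]
    with N h1 h2 h3 h4 hqN hqe hN
  have hN' : (0 : ℝ) < N := Nat.cast_pos.2 hN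
  have hNt : 0 < N * t := mul_pos hN' ht
  set Z := momentGen N t lam fun σ => U N σ ω with hZ
  have hmean : lam * ∑ σ, ((2 : ℝ) ^ N)⁻¹ * U N σ ω ≤ N * ε := by
    have h := (exp_neg_mul_mean_le_boltzmannMean N _ _).trans h2
    rw [Real.exp_le_exp, neg_sq, add_sub_cancel, neg_mul, neg_neg] at h
    exact le_of_mul_le_mul_left (by linarith) hs₀
  have hlow1 : Real.exp (-(t * (N * ε))) ≤ Z := exp_le_momentGen_of_mean_le ht.le hmean
  have hZpos : 0 < Z := (Real.exp_pos _).trans_le hlow1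
  have hlow2 : Real.exp (-(t * N) + N * (remPressure (t * lam) - t * ε)) ≤ Z := by
    rw [Real.exp_add]
    exact (mul_le_mul_of_nonneg_left h4 (Real.exp_pos _).le).trans
      (exp_mul_boltzmannMean_le_momentGen ht.le lam _)
  have hup : Z ≤ Real.exp (N * t * (θ + 3 * ε)) := by
    calc Z ≤ Real.exp (N * (θ + 2 * ε) * t) * (1 - q)⁻¹ := by
          refine momentGen_le hN hs₀.le hst hε hθ0 (h1.trans_eq ?_) (h3.trans ?_)
            (add_le_add_right hqN _) hq1
          · congr 1
            ring
          · rw [Real.exp_le_exp]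
            nlinarith [mul_le_mul_of_nonneg_left (remPressure_le_mul_max ht (t * lam)) hN'.le]
      _ ≤ Real.exp (N * (θ + 2 * ε) * t) * Real.exp (N * (ε * t)) := by gcongr
      _ = Real.exp (N * t * (θ + 3 * ε)) := by
          rw [← Real.exp_add]
          congr 1
          ring
  rw [← Real.le_log_iff_exp_le hZpos] at hlow1 hlow2
  rw [← Real.log_le_iff_le_exp hZpos] at hup
  rw [abs_le]
  constructor
  · rw [neg_le_sub_iff_le_add, ← sub_le_iff_le_add, le_inv_mul_iff₀ hNt]
    rcases max_choice 0 (t⁻¹ * remPressure (t * lam) - 1) with h | h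
    · rw [hθ, h]
      nlinarith [mul_pos hNt hε]
    · rw [hθ, h]
      have : N * t * (t⁻¹ * remPressure (t * lam) - 1 - 3 * ε) =
          -(t * N) + N * (remPressure (t * lam) - t * ε) - 2 * (N * t * ε) := by
        field_simp
        ring
      nlinarith [mul_pos hNt hε]
  · rw [sub_le_iff_le_add, inv_mul_le_iff₀ hNt]
    linarith

theorem theorem1 {Ω : Type*} [MeasurableSpace Ω] (P : Measure Ω) [IsProbabilityMeasure P]
    (U : (N : ℕ) → SpinConfig N → Ω → ℝ) (hU : ∀ N, IsREM N (U N) P)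
    (t lam : ℝ) (ht : 0 < t) (hlam : 0 ≤ lam) :
    ∀ᵐ ω ∂P, Tendsto
      (fun N : ℕ => ((N : ℝ) * t)⁻¹ * Real.log (momentGen N t lam (fun σ => U N σ ω)))
      atTop (𝓝 (max 0 (t⁻¹ * remPressure (t * lam) - 1))) := by
  have h := ae_all_iff.2 fun k : ℕ => IsREM.ae_eventually_abs_log_momentGen_sub_le hU ht hlam
    (ε := 1 / ((k : ℝ) + 1)) (by positivity)
  filter_upwards [h] with ω hω
  rw [Metric.tendsto_nhds]
  intro ε hε
  obtain ⟨k, hk⟩ := exists_nat_one_div_lt (show 0 < ε / 3 by positivity)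
  filter_upwards [hω k] with N hN
  rw [Real.dist_eq]
  linarith
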